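/- **Theorem (Probability density function of the wrapped normal distribution in $\mathbb P_K^n$).** Let $K<0$, $n\ge 0$, $R=1/\sqrt{-K}$. On $\mathbb R^{n+1}\ni(\xi;x)$ let $\langle (\xi;x),(\eta;y)\rangle_{\mathcal L}=-\xi\eta+\langle x,y\rangle$, let $\mathbb H_K^n=\{p:\langle p,p\rangle_{\mathcal L}=1/K,\ \xi>0\}$ be the hyperboloid with the induced metric and origin $\mu_0=(R;0)$, and let $\mathbb P_K^n=\{x\in\mathbb R^n:\|x\|^2<-1/K\}$ be the Poincaré ball with metric $\langle u,v\rangle_x=(\lambda_x^K)^2\langle u,v\rangle$, $\lambda_x^K=2/(1+K\|x\|^2)$, and origin $\mu_0=0$. Let $$\rho_K^{-1}(y)=\Big(\tfrac1{\sqrt{|K|}}\tfrac{1-K\|y\|^2}{1+K\|y\|^2};\ \tfrac{2y}{1+K\|y\|^2}\Big)$$ be the inverse stereographic projection, and let $$d_{\mathbb P}(x,y)=\tfrac1{\sqrt{-K}}\operatorname{arcosh}\Big(1-\tfrac{2K\|x-y\|^2}{(1+K\|x\|^2)(1+K\|y\|^2)}\Big)$$ be the Poincaré distance. For $\mathcal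 M\in\{\mathbb H_K^n,\mathbb P_K^n\}$, $\mu\in\mathcal M$ and a symmetric positive definite $\Sigma\in\mathbb R^{n\times n}$, the wrapped normal distribution $\mathrm{WN}_{\mathcal M}(\mu,\Sigma)$ is the law of $f(v)$, where $f=\exp_\mu\circ \mathrm{PT}_{\mu_0\to\mu}$ ($\exp$ the Riemannian exponential map, $\mathrm{PT}$ parallel transport along the geodesic) and $v\sim\mathcal N(0,\Sigma)$ in $T_{\mu_0}\mathcal M$. Here the coordinates of $v$ refer to the basis of $T_{\mu_0}\mathcal M$ that is orthonormal for the Riemannian metric: $(0;e_1),\dots,(0;e_n)$ for the hyperboloid and $e_1/\lambda_0^K,\dots,e_n/\lambda_0^K$, with $\lambda_0^K=2$, for the ball. Put $$\log \mathrm{WN}_{\mathcal M}(z;\mu,\Sigma)=\log\mathcal N(v;0,\Sigma)-\log\Big|\det\frac{\partial f}{\partial v}\Big|,\qquad v=f^{-1}(z)=\mathrm{PT}_{\mu\to\mu_0}(\log_\mu z),$$ where the determinant is taken with respect to orthonormal bases of the tangent spaces. Let $\mu\in\mathbb P_K^n$. Then: 1. For every symmetric positive definite $\Sigma$, the function $\log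 \mathrm{WN}_{\mathbb P_K^n}(\cdot\,;\mu,\Sigma)$ is the log-density of the distribution $\mathrm{WN}_{\mathbb P_K^n}(\mu,\Sigma)$ with respect to the Riemannian volume of $\mathbb P_K^n$, and $\log \mathrm{WN}_{\mathbb H_K^n}(\cdot\,;\rho_K^{-1}(\mu),\Sigma)$ is the log-density of $\mathrm{WN}_{\mathbb H_K^n}(\rho_K^{-1}(\mu),\Sigma)$ with respect to the Riemannian volume of $\mathbb H_K^n$. For all $z\in\mathbb P_K^n$ one has $\rho_K^{-1}(z)\in\mathbb H_K^n$ and $$\log \mathrm{WN}_{\mathbb P_K^n}(z;\mu,\Sigma)=\log \mathrm{WN}_{\mathbb H_K^n}(\rho_K^{-1}(z);\rho_K^{-1}(\mu),\Sigma).$$ 2. For every $\sigma>0$ and $z\in\mathbb P_K^n$, with $d=d_{\mathbb P}(\mu,z)$, $$\log \mathrm{WN}_{\mathbb P_K^n}(z;\mu,\sigma^2 I)=-\frac{d^2}{2\sigma^2}-\frac n2\log(2\pi\sigma^2)+(n-1)\log\frac{\sqrt{-K}\,d}{\sinh(\sqrt{-K}\,d)},$$ where the last quotient is read as $1$ when $z=\mu$.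 -/

import Mathlib

open MeasureTheory ProbabilityTheory

noncomputable section

namespace WrappedNormal

/-- Coordinate space `ℝⁿ` with the Euclidean inner product. -/
abbrev Coord (n : ℕ) : Type := EuclideanSpace ℝ (Fin n)

/-- The ambient space `ℝⁿ⁺¹` of the hyperboloid, its vectors written in blocks `(ξ; x)` with first
coordinate `ξ ∈ ℝ` and remaining coordinates `x ∈ ℝⁿ`. (No norm of this space is used below,
only its topology and its vector space structure.) -/
abbrev Ambient (n : ℕ) : Type := ℝ × Coord n

/-! ### Gaussian densities, Riemannian Jacobians and Riemannian volume -/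

/-- The density of the centred normal distribution `N(0, S)` on `ℝⁿ`. -/
def gaussianDensity {n : ℕ} (S : Matrix (Fin n) (Fin n) ℝ) (v : Coord n) : ℝ :=
  Real.exp (-(v.ofLp ⬝ᵥ (S⁻¹.mulVec v.ofLp)) / 2) / √((2 * Real.pi) ^ n * S.det)

/-- The determinant of a linear map `D` from `ℝⁿ` to an `n`-dimensional inner product space
(inside `V`, with inner product `g`), taken with respect to orthonormal bases and up to sign:
`√ det (g (D eᵢ) (D eⱼ))ᵢⱼ`. -/
def jacobian {n : ℕ} {V : Type} [NormedAddCommGroup V] [NormedSpace ℝ V]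
    (g : V → V → ℝ) (D : Coord n →L[ℝ] V) : ℝ :=
  √(Matrix.of fun i j : Fin n =>
    g (D (EuclideanSpace.single i 1)) (D (EuclideanSpace.single j 1))).det

/-- The Riemannian volume measure `√|G(x)| dx` of the manifold that is parametrized by
`φ : U → V` and carries the inner product `g p` on its tangent space at `p`. -/
def riemannianVolume {n : ℕ} {V : Type} [NormedAddCommGroup V] [NormedSpace ℝ V]
    [MeasurableSpace V] (g : V → V → V → ℝ) (U : Set (Coord n)) (φ : Coord n → V) : Measure V :=
  (((volume : Measure (Coord n)).restrict U).withDensity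
    fun x => ENNReal.ofReal (jacobian (g (φ x)) (fderiv ℝ φ x))).map φ

/-! ### The hyperboloid, for `K < 0` -/

/-- The radius `R = 1 / √(-K)`. -/
def radius (K : ℝ) : ℝ := 1 / √(-K)

/-- The Lorentz inner product. -/
def lorentz {n : ℕ} (x y : Ambient n) : ℝ := -(x.1 * y.1) + inner ℝ x.2 y.2

/-- The Lorentz norm (used for spacelike and zero vectors). -/
def lorentzNorm {n : ℕ} (v : Ambient n) : ℝ := √(lorentz v v)

/-- The hyperboloid of curvature `K < 0` (its upper sheet). -/
def hyperboloid (K : ℝ) (n : ℕ) : Set (Ambient n) := {x | lorentz x x = 1 / K ∧ 0 < x.1}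

/-- The origin `μ₀ = (R; 0)` of the hyperboloid. -/
def originH (K : ℝ) (n : ℕ) : Ambient n := (radius K, 0)

/-- The exponential map of the hyperboloid. -/
def expH {n : ℕ} (K : ℝ) (x v : Ambient n) : Ambient n :=
  Real.cosh (lorentzNorm v / radius K) • x
    + (Real.sinh (lorentzNorm v / radius K) * (radius K / lorentzNorm v)) • v

/-- The logarithmic map of the hyperboloid (equal to `0` when `x = y`). -/
def logH {n : ℕ} (K : ℝ) (x y : Ambient n) : Ambient n :=
  (Real.arcosh (K * lorentz x y) / √((K * lorentz x y) ^ 2 - 1)) • (y - (K * lorentz x y) • x)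

/-- Parallel transport from `x` to `y` along the geodesic of the hyperboloid. -/
def transportH {n : ℕ} (K : ℝ) (x y v : Ambient n) : Ambient n :=
  v + (lorentz y v / (radius K ^ 2 - lorentz x y)) • (x + y)

/-- The Riemannian volume of the hyperboloid, in the parametrization by the last `n` coordinates. -/
def volumeH (K : ℝ) (n : ℕ) : Measure (Ambient n) :=
  riemannianVolume (fun _ => lorentz) Set.univ fun x : Coord n => (√(‖x‖ ^ 2 - 1 / K), x)

/-- The map `v ↦ exp_μ (PT_{μ₀ → μ} v)`, where a tangent vector at `μ₀` is given by its coordinates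
in the orthonormal basis `(0; e₁), …, (0; eₙ)` of the tangent space at `μ₀`. -/
def wrapH {n : ℕ} (K : ℝ) (μ : Ambient n) (v : Coord n) : Ambient n :=
  expH K μ (transportH K (originH K n) μ (0, v))

/-- The coordinates of `PT_{μ → μ₀} (log_μ z)` in the same basis. -/
def unwrapH {n : ℕ} (K : ℝ) (μ z : Ambient n) : Coord n :=
  (transportH K μ (originH K n) (logH K μ z)).2

/-- The wrapped normal distribution on the hyperboloid: the law of `exp_μ (PT_{μ₀ → μ} v)` for
`v ∼ N(0, S)` in the tangent space at `μ₀`. -/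
def wrappedNormalH {n : ℕ} (K : ℝ) (μ : Ambient n) (S : Matrix (Fin n) (Fin n) ℝ) :
    Measure (Ambient n) :=
  (multivariateGaussian 0 S).map (wrapH K μ)

/-- The log-density `log N(v; 0, S) - log det (∂f/∂v)`, with `f = exp_μ ∘ PT_{μ₀ → μ}` and
`v = f⁻¹(z)`, of the wrapped normal distribution on the hyperboloid. -/
def logWNH {n : ℕ} (K : ℝ) (z μ : Ambient n) (S : Matrix (Fin n) (Fin n) ℝ) : ℝ :=
  Real.log (gaussianDensity S (unwrapH K μ z))
    - Real.log (jacobian lorentz (fderiv ℝ (wrapH K μ) (unwrapH K μ z)))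

/-! ### The Poincaré ball, for `K < 0` -/

/-- The Poincaré ball of curvature `K < 0`. -/
def poincareBall (K : ℝ) (n : ℕ) : Set (Coord n) := {x | inner ℝ x x < -(1 / K)}

/-- The inverse stereographic projection, from the Poincaré ball to the hyperboloid. -/
def rhoInv {n : ℕ} (K : ℝ) (y : Coord n) : Ambient n :=
  (1 / √|K| * ((1 - K * ‖y‖ ^ 2) / (1 + K * ‖y‖ ^ 2)), (2 / (1 + K * ‖y‖ ^ 2)) • y)

/-- The conformal factor. -/
def conformalFactor {n : ℕ} (K : ℝ) (x : Coord n) : ℝ := 2 / (1 + K * ‖x‖ ^ 2)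

/-- The Riemannian metric of the Poincaré ball at `x`. -/
def metricP {n : ℕ} (K : ℝ) (x u v : Coord n) : ℝ := conformalFactor K x ^ 2 * inner ℝ u v

/-- Möbius addition. -/
def mobiusAdd {n : ℕ} (K : ℝ) (x y : Coord n) : Coord n :=
  (1 - 2 * K * inner ℝ x y + K ^ 2 * ‖x‖ ^ 2 * ‖y‖ ^ 2)⁻¹ •
    ((1 - 2 * K * inner ℝ x y - K * ‖y‖ ^ 2) • x + (1 + K * ‖x‖ ^ 2) • y)

/-- The Poincaré distance. -/
def distP {n : ℕ} (K : ℝ) (x y : Coord n) : ℝ :=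
  1 / √(-K) *
    Real.arcosh (1 - 2 * K * ‖x - y‖ ^ 2 / ((1 + K * ‖x‖ ^ 2) * (1 + K * ‖y‖ ^ 2)))

/-- The exponential map of the Poincaré ball. -/
def expP {n : ℕ} (K : ℝ) (x v : Coord n) : Coord n :=
  mobiusAdd K x
    ((Real.tanh (√(-K) * (conformalFactor K x * ‖v‖ / 2)) / (√(-K) * ‖v‖)) • v)

/-- The logarithmic map of the Poincaré ball (equal to `0` when `x = y`). -/
def logP {n : ℕ} (K : ℝ) (x y : Coord n) : Coord n :=
  (2 / (√(-K) * conformalFactor K x) * Real.artanh (√(-K) * ‖mobiusAdd K (-x) y‖)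
    / ‖mobiusAdd K (-x) y‖) • mobiusAdd K (-x) y

/-- Parallel transport of the Poincaré ball from the origin `0` to `y`. -/
def transportFromOriginP {n : ℕ} (K : ℝ) (y v : Coord n) : Coord n :=
  (2 / conformalFactor K y) • v

/-- Parallel transport of the Poincaré ball from `x` to the origin `0`. -/
def transportToOriginP {n : ℕ} (K : ℝ) (x v : Coord n) : Coord n :=
  (conformalFactor K x / 2) • v

/-- The Riemannian volume of the Poincaré ball. -/
def volumeP (K : ℝ) (n : ℕ) : Measure (Coord n) :=
  riemannianVolume (metricP K) (poincareBall K n) id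

/-- The map `v ↦ exp_μ (PT_{0 → μ} v)`, where a tangent vector at `0` is given by its coordinates in
the basis `λ₀⁻¹ e₁, …, λ₀⁻¹ eₙ`, orthonormal for the Riemannian metric at `0`. -/
def wrapP {n : ℕ} (K : ℝ) (μ v : Coord n) : Coord n :=
  expP K μ (transportFromOriginP K μ ((conformalFactor K (0 : Coord n))⁻¹ • v))

/-- The coordinates of `PT_{μ → 0} (log_μ z)` in the same basis. -/
def unwrapP {n : ℕ} (K : ℝ) (μ z : Coord n) : Coord n :=
  conformalFactor K (0 : Coord n) • transportToOriginP K μ (logP K μ z)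

/-- The wrapped normal distribution on the Poincaré ball: the law of `exp_μ (PT_{0 → μ} v)` for
`v ∼ N(0, S)` in the tangent space at `0`. -/
def wrappedNormalP {n : ℕ} (K : ℝ) (μ : Coord n) (S : Matrix (Fin n) (Fin n) ℝ) :
    Measure (Coord n) :=
  (multivariateGaussian 0 S).map (wrapP K μ)

/-- The log-density `log N(v; 0, S) - log det (∂f/∂v)`, with `f = exp_μ ∘ PT_{0 → μ}` and
`v = f⁻¹(z)`, of the wrapped normal distribution on the Poincaré ball. -/
def logWNP {n : ℕ} (K : ℝ) (z μ : Coord n) (S : Matrix (Fin n) (Fin n) ℝ) : ℝ :=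
  Real.log (gaussianDensity S (unwrapP K μ z))
    - Real.log (jacobian (metricP K z) (fderiv ℝ (wrapP K μ) (unwrapP K μ z)))

end WrappedNormal

end

open WrappedNormal

/-!
Write `k = √(-K)`, so that `K = -k²`. Everything is compared with the map
`polar k v = (cosh (k‖v‖) / k; sinhc (k‖v‖) v)`, the exponential map of the hyperboloid at its
origin, where `sinhc x = sinh x / x`.

Parallel transport from the origin to a point `μ` of the hyperboloid is the restriction of a linear
Lorentz isometry `boost k μ` of the ambient space that sends the origin to `μ`. Hence
`wrapH K μ = boost k μ ∘ polar k` (`wrapH_eq_boost_polar`), and its differential pulls the Lorentz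
form back to the same form on `ℝⁿ` as the differential of `polar k` does: at `v` this is
`s² ⟨u, w⟩ + (1 - s²) ⟨v, u⟩ ⟨v, w⟩ / ‖v‖²` with `s = sinhc (k‖v‖)`
(`exists_hasFDerivAt_polar`). Its Gram matrix is a rank-one perturbation of `s² I` with eigenvalue
`1` in the direction of `v`, so the Jacobian of `wrapH K μ` at `v` is `sⁿ / s` (`jacobian_wrapH`).

On the side of the ball, the inverse stereographic projection turns the left Möbius translation by
`x` into `boost k (rhoInv K x)` (`rhoInv_mobiusAdd`), and turns the exponential map of the ball at
`0` into `polar k`; therefore `rhoInv K ∘ wrapP K μ = wrapH K (rhoInv K μ)` (`rhoInv_wrapP`). As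
`rhoInv K` is an isometry (`exists_hasFDerivAt_rhoInv`), the two Jacobians agree. The left
cancellation law of Möbius addition makes `wrapP K μ` a bijection from `ℝⁿ` onto the ball with
inverse `unwrapP K μ`, so that the two log-densities agree; and the Poincaré distance from `μ` to
`wrapP K μ v` is `‖v‖`, which gives the closed form for `Σ = σ² I`.

That the log-densities really are log-densities is the change of variables formula
(`map_eq_riemannianVolume_withDensity`), together with the Lebesgue density of the multivariate
Gaussian (`multivariateGaussian_eq_withDensity`).
-/

namespace WrappedNormal

variable {n : ℕ}

/-! ### Densities and change of variables -/

/-- Change of variables for densities: the push-forward under an injective differentiable map `T` of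
a measure with density `p` has density `h` on the range of `T`, where `|det T'| · (h ∘ T) = p`. -/
theorem map_withDensity_of_hasFDerivAt {T : Coord n → Coord n}
    {T' : Coord n → Coord n →L[ℝ] Coord n} {U : Set (Coord n)} {p h : Coord n → ENNReal}
    (hT : ∀ v, HasFDerivAt T (T' v) v)
    (hinj : Function.Injective T) (hU : Set.range T = U)
    (hph : ∀ v, ENNReal.ofReal |(T' v).det| * h (T v) = p v) :
    ((volume : Measure (Coord n)).withDensity p).map T
      = ((volume : Measure (Coord n)).restrict U).withDensity h := by
  have hcont : Continuous T := continuous_iff_continuousAt.2 fun v => (hT v).continuousAt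
  ext s hs
  have hTs : MeasurableSet (T ⁻¹' s) := hcont.measurable hs
  rw [Measure.map_apply hcont.measurable hs, withDensity_apply _ hTs, withDensity_apply _ hs,
    Measure.restrict_restrict hs, ← hU, ← Set.image_preimage_eq_inter_range,
    lintegral_image_eq_lintegral_abs_det_fderiv_mul volume hTs
      (fun v _ => (hT v).hasFDerivWithinAt) hinj.injOn]
  exact lintegral_congr fun v => (hph v).symm

theorem measurable_jacobian {X V : Type} [MeasurableSpace X] [NormedAddCommGroup V]
    [NormedSpace ℝ V] {g : X → V → V → ℝ} {D : X → Coord n →L[ℝ] V}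
    (h : ∀ i j, Measurable fun x => g x (D x (EuclideanSpace.single i 1))
      (D x (EuclideanSpace.single j 1))) :
    Measurable fun x => jacobian (g x) (D x) := by
  unfold jacobian
  refine Measurable.sqrt ?_
  simp only [Matrix.det_apply, Matrix.of_apply]
  refine Finset.measurable_sum _ fun σ _ => ?_
  exact (Finset.measurable_prod _ fun i _ => h _ _).const_smul _

/-- The Jacobian of a composition with an endomorphism `A` of `ℝⁿ`: the Gram matrix of `D ∘ A` is
`Mᵀ G M`, where `M` is the matrix of `A` and `G` the Gram matrix of `D`. -/
theorem jacobian_comp {V : Type} [NormedAddCommGroup V] [NormedSpace ℝ V] {g : V → V → ℝ}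
    (hl : ∀ w, IsLinearMap ℝ fun u => g u w) (hr : ∀ u, IsLinearMap ℝ (g u))
    (D : Coord n →L[ℝ] V) (A : Coord n →L[ℝ] Coord n) :
    jacobian g (D ∘L A) = |A.det| * jacobian g D := by
  set b := (EuclideanSpace.basisFun (Fin n) ℝ).toBasis
  set M := LinearMap.toMatrix b b (A : Coord n →ₗ[ℝ] Coord n)
  have hA : A.det = M.det := (LinearMap.det_toMatrix b _).symm
  have hAe (i : Fin n) : A (EuclideanSpace.single i 1)
      = ∑ k, M k i • EuclideanSpace.single k (1 : ℝ) := by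
    have := b.sum_repr (A (b i))
    simp only [b, OrthonormalBasis.coe_toBasis, EuclideanSpace.basisFun_apply] at this
    rw [← this]
    refine Finset.sum_congr rfl fun k _ => ?_
    simp [M, b, LinearMap.toMatrix_apply]
  have hG : (Matrix.of fun i j : Fin n => g ((D ∘L A) (EuclideanSpace.single i 1))
        ((D ∘L A) (EuclideanSpace.single j 1)))
      = M.transpose * (Matrix.of fun i j : Fin n => g (D (EuclideanSpace.single i 1))
        (D (EuclideanSpace.single j 1))) * M := by
    ext i j
    have h1 (w : V) : g (D (A (EuclideanSpace.single i 1))) w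
        = ∑ k, M k i * g (D (EuclideanSpace.single k 1)) w := by
      rw [hAe i, map_sum]
      refine (map_sum ((hl w).mk' _) _ _).trans (Finset.sum_congr rfl fun k _ => ?_)
      rw [map_smul]; exact (hl w).map_smul _ _
    have h2 (u : V) : g u (D (A (EuclideanSpace.single j 1)))
        = ∑ k, g u (D (EuclideanSpace.single k 1)) * M k j := by
      rw [hAe j, map_sum]
      refine (map_sum ((hr u).mk' _) _ _).trans (Finset.sum_congr rfl fun k _ => ?_)
      rw [map_smul, mul_comm]; exact (hr u).map_smul _ _
    simp only [Matrix.of_apply, ContinuousLinearMap.comp_apply, Matrix.mul_apply,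
      Matrix.transpose_apply]
    rw [h2]
    exact Finset.sum_congr rfl fun k _ => by rw [h1]
  rw [jacobian, hG, Matrix.det_mul, Matrix.det_mul, Matrix.det_transpose, jacobian, hA,
    show ∀ a b : ℝ, a * b * a = a ^ 2 * b by intros; ring, Real.sqrt_mul (sq_nonneg _),
    Real.sqrt_sq_eq_abs]

/-- Change of variables for densities with respect to a Riemannian volume. The parametrization `φ`
of the manifold need not be the map `φ ∘ T` whose law is considered; by `jacobian_comp`, their
Jacobians differ by the factor `|det T'|` of the Lebesgue change of variables. -/
theorem map_eq_riemannianVolume_withDensity {V : Type} [NormedAddCommGroup V] [NormedSpace ℝ V]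
    [MeasurableSpace V] {g : V → V → V → ℝ} {U : Set (Coord n)} {φ : Coord n → V}
    {T : Coord n → Coord n} {p : Coord n → ℝ} {H : V → ℝ}
    (hl : ∀ x w, IsLinearMap ℝ fun u => g x u w) (hr : ∀ x u, IsLinearMap ℝ (g x u))
    (hφ : Measurable φ) (hφd : ∀ x ∈ U, DifferentiableAt ℝ φ x)
    (hj : Measurable fun x => jacobian (g (φ x)) (fderiv ℝ φ x)) (hH : Measurable H)
    (hT : Differentiable ℝ T) (hinj : Function.Injective T) (hU : Set.range T = U)
    (hpH : ∀ v, jacobian (g (φ (T v))) (fderiv ℝ (φ ∘ T) v) * H (φ (T v)) = p v) :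
    ((volume : Measure (Coord n)).withDensity fun v => ENNReal.ofReal (p v)).map (φ ∘ T)
      = (riemannianVolume g U φ).withDensity fun z => ENNReal.ofReal (H z) := by
  have key := map_withDensity_of_hasFDerivAt (T := T) (U := U)
    (p := fun v => ENNReal.ofReal (p v))
    (h := fun x => ENNReal.ofReal (jacobian (g (φ x)) (fderiv ℝ φ x)) * ENNReal.ofReal (H (φ x)))
    (fun v => (hT v).hasFDerivAt) hinj hU (fun v => by
      have hv : T v ∈ U := hU ▸ Set.mem_range_self v
      have hJ : 0 ≤ jacobian (g (φ (T v))) (fderiv ℝ φ (T v)) := Real.sqrt_nonneg _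
      rw [← hpH, fderiv_comp v (hφd _ hv) (hT v), jacobian_comp (hl _) (hr _),
        ENNReal.ofReal_mul (by positivity), ENNReal.ofReal_mul (abs_nonneg _), mul_assoc])
  rw [← Measure.map_map hφ hT.continuous.measurable, key, riemannianVolume]
  ext s hs
  rw [Measure.map_apply hφ hs, withDensity_apply _ (hφ hs), withDensity_apply _ hs,
    setLIntegral_map hs hH.ennreal_ofReal hφ,
    setLIntegral_withDensity_eq_setLIntegral_mul (g := fun x => ENNReal.ofReal (H (φ x))) _
      hj.ennreal_ofReal (hH.comp hφ).ennreal_ofReal (hφ hs)]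
  rfl

/-! ### The Lebesgue density of the multivariate Gaussian -/

theorem pi_gaussianReal_eq_withDensity :
    Measure.pi (fun _ : Fin n => gaussianReal 0 1)
      = (volume : Measure (Fin n → ℝ)).withDensity
        fun x => ENNReal.ofReal (∏ i, gaussianPDFReal 0 1 (x i)) := by
  refine Measure.pi_eq fun s hs => ?_
  rw [withDensity_apply _ (MeasurableSet.univ_pi hs), volume_pi, Measure.restrict_pi_pi,
    ← ofReal_integral_eq_lintegral_ofReal
      (Integrable.fintype_prod fun i => (integrable_gaussianPDFReal 0 1).restrict)
      (Filter.Eventually.of_forall fun x => Finset.prod_nonneg fun i _ =>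
        gaussianPDFReal_nonneg _ _ _),
    integral_fintype_prod_eq_prod,
    ENNReal.ofReal_prod_of_nonneg fun i _ => integral_nonneg fun x => gaussianPDFReal_nonneg _ _ _]
  exact Finset.prod_congr rfl fun i _ => (gaussianReal_apply_eq_integral 0 one_ne_zero _).symm

theorem stdGaussian_eq_withDensity :
    stdGaussian (Coord n) = (volume : Measure (Coord n)).withDensity
      fun x => ENNReal.ofReal (gaussianDensity 1 x) := by
  rw [← map_pi_eq_stdGaussian, pi_gaussianReal_eq_withDensity]
  have hv := PiLp.volume_preserving_toLp (Fin n)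
  have hd : Measurable fun x : Coord n => ENNReal.ofReal (gaussianDensity 1 x) := by
    unfold gaussianDensity
    simp only [inv_one, Matrix.one_mulVec, dotProduct]
    fun_prop
  ext s hs
  rw [Measure.map_apply hv.measurable hs, withDensity_apply _ (hv.measurable hs),
    withDensity_apply _ hs, ← hv.map_eq, setLIntegral_map hs hd hv.measurable]
  refine lintegral_congr fun x => ?_
  congr 1
  simp only [gaussianPDFReal, gaussianDensity, Finset.prod_mul_distrib, ← Real.exp_sum,
    Finset.prod_const, Finset.card_univ, Fintype.card_fin, inv_one, Matrix.one_mulVec, dotProduct,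
    Matrix.det_one, mul_one, sub_zero, NNReal.coe_one]
  rw [Real.sqrt_eq_rpow, Real.sqrt_eq_rpow, ← Real.rpow_natCast, ← Real.rpow_natCast,
    Real.inv_rpow (by positivity), ← Real.rpow_mul (by positivity), ← Real.rpow_mul (by positivity),
    ← Finset.sum_div, Finset.sum_neg_distrib, mul_comm (n : ℝ)]
  simp only [pow_two, div_eq_inv_mul]

open scoped MatrixOrder in
theorem multivariateGaussian_eq_withDensity {S : Matrix (Fin n) (Fin n) ℝ} (hS : S.PosDef) :
    multivariateGaussian 0 S = (volume : Measure (Coord n)).withDensity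
      fun x => ENNReal.ofReal (gaussianDensity S x) := by
  set A := CFC.sqrt S
  have hAA : A * A = S := CFC.sqrt_mul_sqrt_self _ hS.posSemidef.nonneg
  have hsymm : A.transpose = A := by
    have := (CFC.sqrt_nonneg S).isSelfAdjoint
    simpa [IsSelfAdjoint, Matrix.star_eq_conjTranspose] using this
  have hdet : A.det * A.det = S.det := by rw [← Matrix.det_mul, hAA]
  have hS0 : 0 < S.det := hS.det_pos
  have hA0 : A.det ≠ 0 := fun h => by simp [← hdet, h] at hS0
  have hAu : IsUnit A.det := isUnit_iff_ne_zero.2 hA0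
  set T := Matrix.toEuclideanCLM (𝕜 := ℝ) A
  have hTdet : T.det = A.det := by
    change LinearMap.det (Matrix.toEuclideanLin A) = _
    rw [Matrix.toEuclideanLin_eq_toLin_orthonormal, LinearMap.det_toLin]
  have hTA (x : Coord n) : (T x).ofLp = A.mulVec x.ofLp := rfl
  have hinj : Function.Injective T := fun x y hxy => by
    have : A.mulVec x.ofLp = A.mulVec y.ofLp := by rw [← hTA, ← hTA, hxy]
    exact WithLp.ofLp_injective 2 (Matrix.mulVec_injective_of_isUnit
      ((Matrix.isUnit_iff_isUnit_det A).2 hAu) this)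
  have hsurj : Function.Surjective T := LinearMap.injective_iff_surjective.1 hinj
  rw [multivariateGaussian, stdGaussian_eq_withDensity]
  simp only [zero_add]
  rw [map_withDensity_of_hasFDerivAt (T := T) (T' := fun _ => T) (U := Set.univ)
    (h := fun x => ENNReal.ofReal (gaussianDensity S x)) (fun v => T.hasFDerivAt) hinj
    hsurj.range_eq, Measure.restrict_univ]
  intro v
  rw [← ENNReal.ofReal_mul (abs_nonneg _), hTdet]
  congr 1
  -- `A` is a symmetric square root of `S`, so `(A v)ᵀ S⁻¹ (A v) = vᵀ v`.
  have hq : (T v).ofLp ⬝ᵥ S⁻¹.mulVec (T v).ofLp = v.ofLp ⬝ᵥ v.ofLp := by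
    rw [hTA, ← hAA, Matrix.mul_inv_rev, Matrix.mulVec_mulVec, Matrix.mul_assoc,
      Matrix.nonsing_inv_mul _ hAu, Matrix.mul_one, Matrix.dotProduct_mulVec,
      ← Matrix.mulVec_transpose, Matrix.mulVec_mulVec, Matrix.transpose_nonsing_inv, hsymm,
      Matrix.nonsing_inv_mul _ hAu, Matrix.one_mulVec]
  simp only [gaussianDensity, hq, inv_one, Matrix.one_mulVec, Matrix.det_one, mul_one]
  rw [Real.sqrt_mul (by positivity), ← hdet, Real.sqrt_mul_self_eq_abs]
  have : |A.det| ≠ 0 := abs_ne_zero.2 hA0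
  field_simp

/-! ### The function `sinh x / x` -/

/-- The function `sinh x / x`, with its value `1` at `0`. -/
noncomputable def sinhc (x : ℝ) : ℝ := if x = 0 then 1 else Real.sinh x / x

theorem sinhc_zero : sinhc 0 = 1 := if_pos rfl

theorem sinhc_of_ne_zero {x : ℝ} (hx : x ≠ 0) : sinhc x = Real.sinh x / x := if_neg hx

theorem sinhc_mul_self (x : ℝ) : sinhc x * x = Real.sinh x := by
  rcases eq_or_ne x 0 with rfl | hx
  · simp
  · rw [sinhc_of_ne_zero hx, div_mul_cancel₀ _ hx]

theorem sinhc_pos (x : ℝ) : 0 < sinhc x := by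
  rcases lt_trichotomy x 0 with hx | rfl | hx
  · rw [sinhc_of_ne_zero hx.ne]
    exact div_pos_of_neg_of_neg (Real.sinh_neg_iff.2 hx) hx
  · simp [sinhc_zero]
  · rw [sinhc_of_ne_zero hx.ne']
    exact div_pos (Real.sinh_pos_iff.2 hx) hx

/-- At `x = 0` both sides vanish, the right-hand one because the logarithm
of `0 / 0 = 0` is `0`. -/
theorem log_sinhc (x : ℝ) : Real.log (sinhc x) = Real.log (Real.sinh x / x) := by
  rcases eq_or_ne x 0 with rfl | hx
  · simp [sinhc_zero]
  · rw [sinhc_of_ne_zero hx]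

theorem continuousAt_sinhc_zero : ContinuousAt sinhc 0 := by
  have h : sinhc = dslope Real.sinh 0 := by
    funext x
    rcases eq_or_ne x 0 with rfl | hx
    · simp [sinhc_zero]
    · rw [sinhc_of_ne_zero hx, dslope_of_ne _ hx, slope_def_field]; simp
  rw [h]
  exact continuousAt_dslope_same.2 Real.differentiable_sinh.differentiableAt

theorem hasDerivAt_sinhc {x : ℝ} (hx : x ≠ 0) :
    HasDerivAt sinhc ((Real.cosh x - sinhc x) / x) x := by
  have h := (Real.hasDerivAt_sinh x).div (hasDerivAt_id x) hx
  refine (h.congr_of_eventuallyEq ?_).congr_deriv ?_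
  · filter_upwards [isOpen_ne.mem_nhds hx] with y hy
    exact sinhc_of_ne_zero hy
  · rw [sinhc_of_ne_zero hx]; simp only [id]; field_simp

/-! ### The exponential map at the origin of the hyperboloid -/

/-- The exponential map at the origin of the hyperboloid of curvature `-k²`, in the orthonormal
basis `(0; e₁), …, (0; eₙ)` of the tangent space. -/
noncomputable def polar (k : ℝ) (v : Coord n) : Ambient n :=
  (Real.cosh (k * ‖v‖) / k, sinhc (k * ‖v‖) • v)

theorem hasFDerivAt_norm_of_ne_zero {v : Coord n} (hv : v ≠ 0) :
    HasFDerivAt (fun x : Coord n => ‖x‖) (‖v‖⁻¹ • innerSL ℝ v) v := by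
  have h := (hasStrictFDerivAt_norm_sq v).hasFDerivAt.sqrt (by positivity)
  simp only [Real.sqrt_sq (norm_nonneg _)] at h
  refine h.congr_fderiv ?_
  ext u
  have : ‖v‖ ≠ 0 := norm_ne_zero_iff.2 hv
  simp
  field_simp

/-- The hyperbolic metric in geodesic polar coordinates: lengths are unchanged in the radial
direction and are multiplied by `sinhc (k‖v‖)` orthogonally to it. At `v = 0` the formula
reads `⟨u, w⟩`. -/
theorem exists_hasFDerivAt_polar {k : ℝ} (hk : 0 < k) (v : Coord n) :
    ∃ D : Coord n →L[ℝ] Ambient n, HasFDerivAt (polar k) D v ∧ ∀ u w,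
      lorentz (D u) (D w) = sinhc (k * ‖v‖) ^ 2 * inner ℝ u w
        + (1 - sinhc (k * ‖v‖) ^ 2) / ‖v‖ ^ 2 * (inner ℝ v u * inner ℝ v w) := by
  rcases eq_or_ne v 0 with rfl | hv
  -- At `v = 0` the norm is not differentiable; there `cosh x = 1 + o(x)` and `sinhc x = 1 + o(1)`.
  · refine ⟨(0 : Coord n →L[ℝ] ℝ).prod (ContinuousLinearMap.id ℝ _), ?_, fun u w => by
      simp [lorentz, sinhc_zero]⟩
    have hn : Filter.Tendsto (fun v : Coord n => k * ‖v‖) (nhds 0) (nhds 0) :=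
      (by fun_prop : Continuous fun v : Coord n => k * ‖v‖).tendsto' _ _ (by simp)
    have hO : (fun v : Coord n => k * ‖v‖) =O[nhds 0] fun v => v :=
      (Asymptotics.isBigO_refl _ _).norm_left.const_mul_left k
    refine HasFDerivAt.prodMk ?_ ?_
    · rw [hasFDerivAt_iff_isLittleO_nhds_zero]
      have h := (hasDerivAt_iff_isLittleO_nhds_zero.1 (Real.hasDerivAt_cosh 0)).comp_tendsto hn
      refine ((h.trans_isBigO hO).const_mul_left k⁻¹).congr_left fun v => ?_
      simp; ring
    · rw [hasFDerivAt_iff_isLittleO_nhds_zero]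
      have h1 : (fun v : Coord n => sinhc (k * ‖v‖) - 1) =o[nhds 0] fun _ => (1 : ℝ) := by
        rw [Asymptotics.isLittleO_one_iff]
        have := (continuousAt_sinhc_zero.tendsto.comp hn).sub_const 1
        simpa [sinhc_zero] using this
      have h2 := h1.smul_isBigO (Asymptotics.isBigO_refl (fun v : Coord n => v) (nhds 0))
      refine (h2.congr_left fun v => ?_).congr_right fun v => by simp
      simp [sub_smul]
  · have hr : ‖v‖ ≠ 0 := norm_ne_zero_iff.2 hv
    have hkr : k * ‖v‖ ≠ 0 := mul_ne_zero hk.ne' hr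
    have hn := (hasFDerivAt_norm_of_ne_zero hv).const_mul k
    have h1 := ((Real.hasDerivAt_cosh (k * ‖v‖)).comp_hasFDerivAt v hn).mul_const k⁻¹
    have h2 := ((hasDerivAt_sinhc hkr).comp_hasFDerivAt v hn).smul (hasFDerivAt_id v)
    refine ⟨_, h1.prodMk h2, fun u w => ?_⟩
    have hs := sinhc_mul_self (k * ‖v‖)
    have hc := Real.cosh_sq' (k * ‖v‖)
    rw [← hs] at hc
    simp only [lorentz, ContinuousLinearMap.prod_apply, smul_apply,
      add_apply, ContinuousLinearMap.smulRight_apply, innerSL_apply_apply,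
      ContinuousLinearMap.id_apply, id, Function.comp,
      inner_add_left, inner_add_right,
      inner_smul_left, inner_smul_right, smul_eq_mul, ← hs, real_inner_self_eq_norm_sq,
      RCLike.conj_to_real, real_inner_comm u v]
    generalize sinhc (k * ‖v‖) = s at *
    generalize Real.cosh (k * ‖v‖) = c at *
    field_simp
    -- What remains is `cosh² = 1 + sinh²`, multiplied by `⟨v, u⟩ ⟨v, w⟩`.
    linear_combination (inner ℝ u v * inner ℝ v w) * hc

/-! ### Lorentz boosts and wrapping on the hyperboloid -/

/-- For `μ` on the hyperboloid of curvature `-k²`, the linear Lorentz isometry of the ambient space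
that sends the origin `(1 / k; 0)` of the hyperboloid to `μ` and restricts to parallel transport on the
tangent space at the origin. -/
noncomputable def boost (k : ℝ) (μ : Ambient n) : Ambient n →L[ℝ] Ambient n :=
  ((k * μ.1) • ContinuousLinearMap.fst ℝ ℝ (Coord n)
      + k • (innerSL ℝ μ.2 ∘L ContinuousLinearMap.snd ℝ ℝ (Coord n))).prod
    (ContinuousLinearMap.snd ℝ ℝ (Coord n)
      + (k • ContinuousLinearMap.fst ℝ ℝ (Coord n) + (k ^ 2 / (1 + k * μ.1)) •
        (innerSL ℝ μ.2 ∘L ContinuousLinearMap.snd ℝ ℝ (Coord n))).smulRight μ.2)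

theorem boost_apply (k : ℝ) (μ p : Ambient n) : boost k μ p =
    (k * μ.1 * p.1 + k * inner ℝ μ.2 p.2,
      p.2 + (k * p.1 + k ^ 2 / (1 + k * μ.1) * inner ℝ μ.2 p.2) • μ.2) := by
  simp [boost]

theorem radius_neg_sq {k : ℝ} (hk : 0 < k) : radius (-k ^ 2) = 1 / k := by
  rw [radius, neg_neg, Real.sqrt_sq hk.le]

theorem sq_fst_of_mem_hyperboloid {k : ℝ} {μ : Ambient n} (hμ : μ ∈ hyperboloid (-k ^ 2) n) :
    μ.1 ^ 2 = ‖μ.2‖ ^ 2 + 1 / k ^ 2 := by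
  have h := hμ.1
  simp only [lorentz, real_inner_self_eq_norm_sq] at h
  rw [div_neg] at h
  linarith

theorem lorentz_boost {k : ℝ} (hk : 0 < k) {μ : Ambient n} (hμ : μ ∈ hyperboloid (-k ^ 2) n)
    (p q : Ambient n) : lorentz (boost k μ p) (boost k μ q) = lorentz p q := by
  have h1 := sq_fst_of_mem_hyperboloid hμ
  have h2 : 1 + k * μ.1 ≠ 0 := by have := hμ.2; positivity
  have h3 : ‖μ.2‖ ^ 2 = μ.1 ^ 2 - 1 / k ^ 2 := by linarith
  simp only [boost_apply, lorentz, inner_add_left, inner_add_right, inner_smul_left,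
    inner_smul_right, real_inner_self_eq_norm_sq, RCLike.conj_to_real, real_inner_comm μ.2 p.2, h3]
  field_simp
  ring

theorem boost_origin {k : ℝ} (hk : 0 < k) (μ : Ambient n) : boost k μ (1 / k, 0) = μ := by
  rw [boost_apply]
  ext
  · simp
    field_simp
  · simp [hk.ne']

theorem transportH_origin {k : ℝ} (hk : 0 < k) {μ : Ambient n} (hμ : 0 < μ.1)
    (v : Coord n) : transportH (-k ^ 2) (originH (-k ^ 2) n) μ (0, v) = boost k μ (0, v) := by
  simp only [transportH, originH, radius_neg_sq hk, boost_apply, lorentz]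
  have h2 : 1 + k * μ.1 ≠ 0 := by positivity
  have h2' : (1 / k) ^ 2 - -(1 / k * μ.1) ≠ 0 := by
    rw [show (1 / k) ^ 2 - -(1 / k * μ.1) = (1 + k * μ.1) / k ^ 2 by field_simp; ring]
    positivity
  refine Prod.ext ?_ ?_
  · simp
    field_simp
  · simp
    field_simp

/-- `polar k v` as a combination of the origin and a tangent vector there. -/
theorem polar_eq (k : ℝ) (v : Coord n) :
    polar k v = Real.cosh (k * ‖v‖) • (1 / k, 0) + sinhc (k * ‖v‖) • ((0 : ℝ), v) := by
  ext <;> simp [polar, div_eq_mul_inv]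

theorem lorentzNorm_boost {k : ℝ} (hk : 0 < k) {μ : Ambient n} (hμ : μ ∈ hyperboloid (-k ^ 2) n)
    (v : Coord n) : lorentzNorm (boost k μ (0, v)) = ‖v‖ := by
  rw [lorentzNorm, lorentz_boost hk hμ]
  simp [lorentz]

/-- The exponential map commutes with Lorentz isometries, so wrapping at `μ` is wrapping at the
origin followed by the isometry `boost k μ`. -/
theorem wrapH_eq_boost_polar {k : ℝ} (hk : 0 < k) {μ : Ambient n}
    (hμ : μ ∈ hyperboloid (-k ^ 2) n) (v : Coord n) :
    wrapH (-k ^ 2) μ v = boost k μ (polar k v) := by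
  rw [wrapH, transportH_origin hk hμ.2, expH, lorentzNorm_boost hk hμ, polar_eq, map_add, map_smul,
    map_smul, boost_origin hk, radius_neg_sq hk]
  rcases eq_or_ne v 0 with rfl | hv
  -- In `expH` the factor `R / 0` is `0`, which is harmless since it multiplies the zero vector.
  · simp [Prod.mk_zero_zero]
  have hr : ‖v‖ ≠ 0 := norm_ne_zero_iff.2 hv
  rw [sinhc_of_ne_zero (by positivity), div_div_eq_mul_div, div_one, mul_comm ‖v‖]
  congr 2
  field_simp

/-- The distance on the hyperboloid from `μ` to `wrapH μ v` is `‖v‖`, in terms of its hyperbolic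
cosine. -/
theorem neg_sq_mul_lorentz_wrapH {k : ℝ} (hk : 0 < k) {μ : Ambient n}
    (hμ : μ ∈ hyperboloid (-k ^ 2) n) (v : Coord n) :
    -k ^ 2 * lorentz μ (wrapH (-k ^ 2) μ v) = Real.cosh (k * ‖v‖) := by
  rw [wrapH_eq_boost_polar hk hμ]
  nth_rw 1 [← boost_origin hk μ]
  rw [lorentz_boost hk hμ]
  simp [lorentz, polar]
  field_simp

theorem unwrapH_wrapH {k : ℝ} (hk : 0 < k) {μ : Ambient n}
    (hμ : μ ∈ hyperboloid (-k ^ 2) n) (v : Coord n) :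
    unwrapH (-k ^ 2) μ (wrapH (-k ^ 2) μ v) = v := by
  have hlog : logH (-k ^ 2) μ (wrapH (-k ^ 2) μ v) = boost k μ (0, v) := by
    rw [logH, neg_sq_mul_lorentz_wrapH hk hμ, wrapH_eq_boost_polar hk hμ,
      Real.arcosh_cosh (by positivity),
      ← Real.sinh_sq, Real.sqrt_sq (Real.sinh_nonneg_iff.2 (by positivity)), polar_eq, map_add,
      map_smul, map_smul, boost_origin hk, add_sub_cancel_left, smul_smul]
    rcases eq_or_ne v 0 with rfl | hv
    · simp [Prod.mk_zero_zero]
    have hkr : k * ‖v‖ ≠ 0 := mul_ne_zero hk.ne' (norm_ne_zero_iff.2 hv)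
    have hs : Real.sinh (k * ‖v‖) ≠ 0 := fun h => hkr (Real.sinh_eq_zero.1 h)
    rw [sinhc_of_ne_zero hkr, div_mul_div_cancel₀ hs, div_self hkr, one_smul]
  rw [unwrapH, hlog, transportH, originH, radius_neg_sq hk]
  have h2 : 1 + k * μ.1 ≠ 0 := by have := hμ.2; positivity
  simp [boost_apply, lorentz]
  rw [add_assoc, add_eq_left]
  rw [← add_smul, show (k ^ 2)⁻¹ + μ.1 * k⁻¹ = (1 + k * μ.1) / k ^ 2 by field_simp]
  convert zero_smul ℝ μ.2
  field_simp
  ring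

/-! ### The Poincaré ball and Möbius addition -/

theorem mem_poincareBall {k : ℝ} (hk : 0 < k) {x : Coord n} :
    x ∈ poincareBall (-k ^ 2) n ↔ 0 < 1 - k ^ 2 * ‖x‖ ^ 2 := by
  have : 0 < k ^ 2 := by positivity
  rw [poincareBall, Set.mem_ofPred_eq, real_inner_self_eq_norm_sq, div_neg, neg_neg,
    lt_div_iff₀ this, mul_comm, sub_pos]

theorem neg_mem_poincareBall {K : ℝ} {x : Coord n} (hx : x ∈ poincareBall K n) :
    -x ∈ poincareBall K n := by
  simpa [poincareBall] using hx

/-- By the Cauchy-Schwarz inequality, the denominator of `mobiusAdd` is at least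
`(1 - k‖x‖ · k‖y‖)²`. -/
theorem mobiusAdd_denom_pos {k : ℝ} (hk : 0 < k) {x y : Coord n}
    (hx : x ∈ poincareBall (-k ^ 2) n) (hy : y ∈ poincareBall (-k ^ 2) n) :
    0 < 1 + 2 * k ^ 2 * inner ℝ x y + k ^ 4 * ‖x‖ ^ 2 * ‖y‖ ^ 2 := by
  rw [mem_poincareBall hk] at hx hy
  have hx1 : k * ‖x‖ < 1 := by
    rw [← abs_of_nonneg (by positivity : 0 ≤ k * ‖x‖), ← sq_lt_one_iff_abs_lt_one]; linarith
  have hy1 : k * ‖y‖ < 1 := by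
    rw [← abs_of_nonneg (by positivity : 0 ≤ k * ‖y‖), ← sq_lt_one_iff_abs_lt_one]; linarith
  have hxy : (k * ‖x‖) * (k * ‖y‖) < 1 :=
    mul_lt_one_of_nonneg_of_lt_one_left (by positivity) hx1 hy1.le
  have hin : -(‖x‖ * ‖y‖) ≤ inner ℝ x y := (abs_le.1 (abs_real_inner_le_norm x y)).1
  have h2 : 0 ≤ k ^ 2 * (inner ℝ x y + ‖x‖ * ‖y‖) := by
    apply mul_nonneg (by positivity); linarith
  have h3 : 0 < (1 - (k * ‖x‖) * (k * ‖y‖)) ^ 2 := by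
    have : 0 < 1 - (k * ‖x‖) * (k * ‖y‖) := by linarith
    positivity
  nlinarith

/-- Möbius addition for the curvature `-k²`, with the signs resolved. -/
theorem mobiusAdd_eq (k : ℝ) (x y : Coord n) : mobiusAdd (-k ^ 2) x y =
    (1 + 2 * k ^ 2 * inner ℝ x y + k ^ 4 * ‖x‖ ^ 2 * ‖y‖ ^ 2)⁻¹ •
      ((1 + 2 * k ^ 2 * inner ℝ x y + k ^ 2 * ‖y‖ ^ 2) • x + (1 - k ^ 2 * ‖x‖ ^ 2) • y) := by
  rw [mobiusAdd]
  congr 2 <;> ring_nf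

/-- The identity behind the closure of the ball under Möbius addition. -/
theorem one_sub_norm_mobiusAdd {k : ℝ} (hk : 0 < k) {x y : Coord n}
    (hx : x ∈ poincareBall (-k ^ 2) n) (hy : y ∈ poincareBall (-k ^ 2) n) :
    1 - k ^ 2 * ‖mobiusAdd (-k ^ 2) x y‖ ^ 2 = (1 - k ^ 2 * ‖x‖ ^ 2) * (1 - k ^ 2 * ‖y‖ ^ 2) /
      (1 + 2 * k ^ 2 * inner ℝ x y + k ^ 4 * ‖x‖ ^ 2 * ‖y‖ ^ 2) := by
  have hD := mobiusAdd_denom_pos hk hx hy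
  rw [mobiusAdd_eq, norm_smul, mul_pow, norm_add_sq_real, norm_smul, norm_smul, mul_pow, mul_pow,
    inner_smul_left, inner_smul_right, Real.norm_eq_abs, Real.norm_eq_abs, Real.norm_eq_abs,
    sq_abs, sq_abs, sq_abs, RCLike.conj_to_real]
  rw [eq_div_iff hD.ne']
  generalize hDD : 1 + 2 * k ^ 2 * inner ℝ x y + k ^ 4 * ‖x‖ ^ 2 * ‖y‖ ^ 2 = D at *
  field_simp
  rw [← hDD]
  ring

theorem mobiusAdd_mem_poincareBall {k : ℝ} (hk : 0 < k) {x y : Coord n}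
    (hx : x ∈ poincareBall (-k ^ 2) n) (hy : y ∈ poincareBall (-k ^ 2) n) :
    mobiusAdd (-k ^ 2) x y ∈ poincareBall (-k ^ 2) n := by
  have hD := mobiusAdd_denom_pos hk hx hy
  have h := one_sub_norm_mobiusAdd hk hx hy
  rw [mem_poincareBall hk] at *
  rw [h]
  positivity

theorem mobiusAdd_neg_cancel_left {k : ℝ} (hk : 0 < k) {x y : Coord n}
    (hx : x ∈ poincareBall (-k ^ 2) n) (hy : y ∈ poincareBall (-k ^ 2) n) :
    mobiusAdd (-k ^ 2) (-x) (mobiusAdd (-k ^ 2) x y) = y := by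
  have hD := mobiusAdd_denom_pos hk hx hy
  have hW := one_sub_norm_mobiusAdd hk hx hy
  have hB := (mem_poincareBall hk).1 hx
  set w := mobiusAdd (-k ^ 2) x y with hw
  rw [mobiusAdd_eq] at hw
  have hin : inner ℝ x w = ((1 + 2 * k ^ 2 * inner ℝ x y + k ^ 2 * ‖y‖ ^ 2) * ‖x‖ ^ 2
      + (1 - k ^ 2 * ‖x‖ ^ 2) * inner ℝ x y)
        / (1 + 2 * k ^ 2 * inner ℝ x y + k ^ 4 * ‖x‖ ^ 2 * ‖y‖ ^ 2) := by
    rw [hw, inner_smul_right, inner_add_right, inner_smul_right, inner_smul_right,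
      real_inner_self_eq_norm_sq]
    ring
  have hW' : k ^ 2 * ‖w‖ ^ 2 = 1 - (1 - k ^ 2 * ‖x‖ ^ 2) * (1 - k ^ 2 * ‖y‖ ^ 2) /
      (1 + 2 * k ^ 2 * inner ℝ x y + k ^ 4 * ‖x‖ ^ 2 * ‖y‖ ^ 2) := by linarith
  have hden : 1 + 2 * k ^ 2 * inner ℝ (-x) w + k ^ 4 * ‖-x‖ ^ 2 * ‖w‖ ^ 2
      = (1 - k ^ 2 * ‖x‖ ^ 2) ^ 2
        / (1 + 2 * k ^ 2 * inner ℝ x y + k ^ 4 * ‖x‖ ^ 2 * ‖y‖ ^ 2) := by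
    rw [show k ^ 4 * ‖-x‖ ^ 2 * ‖w‖ ^ 2 = k ^ 2 * ‖x‖ ^ 2 * (k ^ 2 * ‖w‖ ^ 2) by
      rw [norm_neg]; ring, hW', inner_neg_left, hin]
    generalize hDD : 1 + 2 * k ^ 2 * inner ℝ x y + k ^ 4 * ‖x‖ ^ 2 * ‖y‖ ^ 2 = D at *
    field_simp
    rw [← hDD]
    ring
  have hnum : 1 + 2 * k ^ 2 * inner ℝ (-x) w + k ^ 2 * ‖w‖ ^ 2
      = (1 - k ^ 2 * ‖x‖ ^ 2) * (1 + 2 * k ^ 2 * inner ℝ x y + k ^ 2 * ‖y‖ ^ 2)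
        / (1 + 2 * k ^ 2 * inner ℝ x y + k ^ 4 * ‖x‖ ^ 2 * ‖y‖ ^ 2) := by
    rw [hW', inner_neg_left, hin]
    generalize hDD : 1 + 2 * k ^ 2 * inner ℝ x y + k ^ 4 * ‖x‖ ^ 2 * ‖y‖ ^ 2 = D at *
    field_simp
    rw [← hDD]
    ring
  rw [mobiusAdd_eq, hden, hnum, norm_neg, hw]
  -- Both sides are combinations of `x` and `y`; the coefficients of `x` cancel.
  generalize 1 + 2 * k ^ 2 * inner ℝ x y + k ^ 4 * ‖x‖ ^ 2 * ‖y‖ ^ 2 = D at *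
  generalize 1 + 2 * k ^ 2 * inner ℝ x y + k ^ 2 * ‖y‖ ^ 2 = A at *
  generalize 1 - k ^ 2 * ‖x‖ ^ 2 = B at *
  match_scalars <;> field_simp
  ring

/-! ### The inverse stereographic projection -/

theorem rhoInv_eq {k : ℝ} (hk : 0 < k) (y : Coord n) : rhoInv (-k ^ 2) y =
    ((1 + k ^ 2 * ‖y‖ ^ 2) / (k * (1 - k ^ 2 * ‖y‖ ^ 2)), (2 / (1 - k ^ 2 * ‖y‖ ^ 2)) • y) := by
  rw [rhoInv, abs_neg, abs_of_pos (by positivity), Real.sqrt_sq hk.le, div_mul_div_comm, one_mul,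
    neg_mul, sub_neg_eq_add, ← sub_eq_add_neg]

theorem rhoInv_mem_hyperboloid {k : ℝ} (hk : 0 < k) {y : Coord n}
    (hy : y ∈ poincareBall (-k ^ 2) n) : rhoInv (-k ^ 2) y ∈ hyperboloid (-k ^ 2) n := by
  have h := (mem_poincareBall hk).1 hy
  rw [rhoInv_eq hk]
  refine ⟨?_, by positivity⟩
  simp only [lorentz, inner_smul_left, inner_smul_right, real_inner_self_eq_norm_sq,
    RCLike.conj_to_real]
  field_simp
  ring

/-- The inverse stereographic projection intertwines left Möbius translation by `x` with the Lorentz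
isometry that moves the origin of the hyperboloid to the image of `x`. -/
theorem rhoInv_mobiusAdd {k : ℝ} (hk : 0 < k) {x y : Coord n}
    (hx : x ∈ poincareBall (-k ^ 2) n) (hy : y ∈ poincareBall (-k ^ 2) n) :
    rhoInv (-k ^ 2) (mobiusAdd (-k ^ 2) x y)
      = boost k (rhoInv (-k ^ 2) x) (rhoInv (-k ^ 2) y) := by
  have hD := mobiusAdd_denom_pos hk hx hy
  have hW := one_sub_norm_mobiusAdd hk hx hy
  have hB := (mem_poincareBall hk).1 hx
  have hY := (mem_poincareBall hk).1 hy
  -- The first coordinate `ξ` of `rhoInv x` satisfies `1 + k ξ = 2 / (1 - k²‖x‖²)`.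
  have hξ : 1 + k * ((1 + k ^ 2 * ‖x‖ ^ 2) / (k * (1 - k ^ 2 * ‖x‖ ^ 2)))
      = 2 / (1 - k ^ 2 * ‖x‖ ^ 2) := by
    field_simp; ring
  rw [rhoInv_eq hk, boost_apply, rhoInv_eq hk x, rhoInv_eq hk y, hW]
  have hW' : 1 + k ^ 2 * ‖mobiusAdd (-k ^ 2) x y‖ ^ 2
    = 2 - (1 - k ^ 2 * ‖x‖ ^ 2) * (1 - k ^ 2 * ‖y‖ ^ 2) /
      (1 + 2 * k ^ 2 * inner ℝ x y + k ^ 4 * ‖x‖ ^ 2 * ‖y‖ ^ 2) := by linarith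
  rw [hW']
  simp only [hξ, inner_smul_left, inner_smul_right, RCLike.conj_to_real]
  refine Prod.ext ?_ ?_
  · simp only
    field_simp
    ring
  · simp only
    rw [mobiusAdd_eq]
    match_scalars <;> field_simp
    ring

/-- The argument of `arcosh` in the Poincaré distance is the one of the hyperboloid distance. -/
theorem lorentz_rhoInv {k : ℝ} (hk : 0 < k) {x y : Coord n}
    (hx : x ∈ poincareBall (-k ^ 2) n) (hy : y ∈ poincareBall (-k ^ 2) n) :
    -k ^ 2 * lorentz (rhoInv (-k ^ 2) x) (rhoInv (-k ^ 2) y)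
      = 1 - 2 * -k ^ 2 * ‖x - y‖ ^ 2 / ((1 + -k ^ 2 * ‖x‖ ^ 2) * (1 + -k ^ 2 * ‖y‖ ^ 2)) := by
  have hB := (mem_poincareBall hk).1 hx
  have hY := (mem_poincareBall hk).1 hy
  rw [rhoInv_eq hk, rhoInv_eq hk, norm_sub_sq_real,
    show ∀ a : ℝ, 1 + -k ^ 2 * a = 1 - k ^ 2 * a by intro a; ring,
    show ∀ a : ℝ, 1 + -k ^ 2 * a = 1 - k ^ 2 * a by intro a; ring]
  simp only [lorentz, inner_smul_left, inner_smul_right, RCLike.conj_to_real]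
  field_simp
  ring

/-! ### Wrapping in the ball -/

/-- The exponential map at the origin of the Poincaré ball of curvature `-k²`, in the basis
`λ₀⁻¹ e₁, …, λ₀⁻¹ eₙ` of the tangent space. -/
noncomputable def ballPolar (k : ℝ) (v : Coord n) : Coord n :=
  (Real.tanh (k * ‖v‖ / 2) / (k * ‖v‖)) • v

theorem mul_norm_ballPolar {k : ℝ} (hk : 0 < k) (v : Coord n) :
    k * ‖ballPolar k v‖ = Real.tanh (k * ‖v‖ / 2) := by
  rcases eq_or_ne v 0 with rfl | hv
  · simp [ballPolar]
  have hr : ‖v‖ ≠ 0 := norm_ne_zero_iff.2 hv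
  have : 0 ≤ Real.tanh (k * ‖v‖ / 2) := by
    rw [Real.tanh_eq_sinh_div_cosh]
    exact div_nonneg (Real.sinh_nonneg_iff.2 (by positivity)) (Real.cosh_pos _).le
  rw [ballPolar, norm_smul, Real.norm_of_nonneg (by positivity)]
  field_simp

theorem ballPolar_mem {k : ℝ} (hk : 0 < k) (v : Coord n) :
    ballPolar k v ∈ poincareBall (-k ^ 2) n := by
  rw [mem_poincareBall hk, ← mul_pow, mul_norm_ballPolar hk, sub_pos, sq_lt_one_iff_abs_lt_one]
  exact Real.abs_tanh_lt_one _

/-- The double-angle formulas for `cosh` and `sinh`, in terms of `tanh` of the half angle. -/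
theorem rhoInv_ballPolar {k : ℝ} (hk : 0 < k) (v : Coord n) :
    rhoInv (-k ^ 2) (ballPolar k v) = polar k v := by
  have hc := Real.cosh_pos (k * ‖v‖ / 2)
  have hcs := Real.cosh_sq' (k * ‖v‖ / 2)
  have h1 : 1 - Real.tanh (k * ‖v‖ / 2) ^ 2 = 1 / Real.cosh (k * ‖v‖ / 2) ^ 2 := by
    rw [Real.tanh_eq_sinh_div_cosh]; field_simp; linarith
  have hco : Real.cosh (k * ‖v‖) = Real.cosh (k * ‖v‖ / 2) ^ 2 + Real.sinh (k * ‖v‖ / 2) ^ 2 := by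
    rw [← Real.cosh_two_mul]; congr 1; ring
  have hsi : Real.sinh (k * ‖v‖) = 2 * Real.sinh (k * ‖v‖ / 2) * Real.cosh (k * ‖v‖ / 2) := by
    rw [← Real.sinh_two_mul]; congr 1; ring
  rw [rhoInv_eq hk, ← mul_pow, mul_norm_ballPolar hk, h1, polar, hco]
  refine Prod.ext ?_ ?_
  · simp only [Real.tanh_eq_sinh_div_cosh]
    field_simp
  · rcases eq_or_ne v 0 with rfl | hv
    · simp [ballPolar]
    have hr : ‖v‖ ≠ 0 := norm_ne_zero_iff.2 hv
    rw [ballPolar, smul_smul, sinhc_of_ne_zero (by positivity), hsi, Real.tanh_eq_sinh_div_cosh]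
    congr 1
    field_simp

theorem conformalFactor_neg_sq (k : ℝ) (x : Coord n) :
    conformalFactor (-k ^ 2) x = 2 / (1 - k ^ 2 * ‖x‖ ^ 2) := by
  rw [conformalFactor, neg_mul, ← sub_eq_add_neg]

theorem wrapP_eq_mobiusAdd {k : ℝ} (hk : 0 < k) {μ : Coord n} (hμ : μ ∈ poincareBall (-k ^ 2) n)
    (v : Coord n) : wrapP (-k ^ 2) μ v = mobiusAdd (-k ^ 2) μ (ballPolar k v) := by
  have hB := (mem_poincareBall hk).1 hμ
  rw [wrapP, expP, transportFromOriginP, conformalFactor_neg_sq, conformalFactor_neg_sq, neg_neg,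
    Real.sqrt_sq hk.le, ballPolar, norm_zero,
    show (2 / (2 / (1 - k ^ 2 * ‖μ‖ ^ 2))) • (2 / (1 - k ^ 2 * (0 : ℝ) ^ 2))⁻¹ • v
      = ((1 - k ^ 2 * ‖μ‖ ^ 2) / 2) • v by rw [smul_smul]; congr 1; field_simp; simp,
    norm_smul, Real.norm_of_nonneg (by positivity), smul_smul]
  rcases eq_or_ne v 0 with rfl | hv
  · simp
  have hr : ‖v‖ ≠ 0 := norm_ne_zero_iff.2 hv
  congr 2
  field_simp

theorem wrapP_mem_poincareBall {k : ℝ} (hk : 0 < k) {μ : Coord n}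
    (hμ : μ ∈ poincareBall (-k ^ 2) n) (v : Coord n) :
    wrapP (-k ^ 2) μ v ∈ poincareBall (-k ^ 2) n := by
  rw [wrapP_eq_mobiusAdd hk hμ]
  exact mobiusAdd_mem_poincareBall hk hμ (ballPolar_mem hk v)

/-- Wrapping in the ball corresponds to wrapping on the hyperboloid. -/
theorem rhoInv_wrapP {k : ℝ} (hk : 0 < k) {μ : Coord n} (hμ : μ ∈ poincareBall (-k ^ 2) n)
    (v : Coord n) :
    rhoInv (-k ^ 2) (wrapP (-k ^ 2) μ v) = wrapH (-k ^ 2) (rhoInv (-k ^ 2) μ) v := by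
  rw [wrapP_eq_mobiusAdd hk hμ, rhoInv_mobiusAdd hk hμ (ballPolar_mem hk v), rhoInv_ballPolar hk,
    wrapH_eq_boost_polar hk (rhoInv_mem_hyperboloid hk hμ)]

theorem unwrapP_eq {k : ℝ} (hk : 0 < k) {μ : Coord n} (hμ : μ ∈ poincareBall (-k ^ 2) n)
    (z : Coord n) : unwrapP (-k ^ 2) μ z =
      (2 / k * Real.artanh (k * ‖mobiusAdd (-k ^ 2) (-μ) z‖) / ‖mobiusAdd (-k ^ 2) (-μ) z‖) •
        mobiusAdd (-k ^ 2) (-μ) z := by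
  have hB := (mem_poincareBall hk).1 hμ
  rw [unwrapP, transportToOriginP, logP, conformalFactor_neg_sq, conformalFactor_neg_sq, neg_neg,
    Real.sqrt_sq hk.le, smul_smul, smul_smul, norm_zero]
  congr 1
  field_simp
  simp

theorem unwrapP_wrapP {k : ℝ} (hk : 0 < k) {μ : Coord n} (hμ : μ ∈ poincareBall (-k ^ 2) n)
    (v : Coord n) : unwrapP (-k ^ 2) μ (wrapP (-k ^ 2) μ v) = v := by
  rw [unwrapP_eq hk hμ, wrapP_eq_mobiusAdd hk hμ,
    mobiusAdd_neg_cancel_left hk hμ (ballPolar_mem hk v), mul_norm_ballPolar hk,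
    Real.artanh_tanh]
  rcases eq_or_ne v 0 with rfl | hv
  · simp [ballPolar]
  have hr : ‖v‖ ≠ 0 := norm_ne_zero_iff.2 hv
  have ht : Real.tanh (k * ‖v‖ / 2) ≠ 0 := fun h => by
    have : k * ‖v‖ / 2 = 0 := Real.tanh_injective (by rw [h, Real.tanh_zero])
    have : 0 < k * ‖v‖ / 2 := by positivity
    linarith
  have hn : ‖ballPolar k v‖ = Real.tanh (k * ‖v‖ / 2) / k := by
    rw [← mul_norm_ballPolar hk]; field_simp
  rw [hn, ballPolar, smul_smul]
  convert one_smul ℝ v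
  field_simp

theorem wrapP_unwrapP {k : ℝ} (hk : 0 < k) {μ z : Coord n} (hμ : μ ∈ poincareBall (-k ^ 2) n)
    (hz : z ∈ poincareBall (-k ^ 2) n) : wrapP (-k ^ 2) μ (unwrapP (-k ^ 2) μ z) = z := by
  have hμ' := neg_mem_poincareBall hμ
  have hw := (mem_poincareBall hk).1 (mobiusAdd_mem_poincareBall hk hμ' hz)
  have hcancel := mobiusAdd_neg_cancel_left hk hμ' hz
  rw [neg_neg] at hcancel
  rw [wrapP_eq_mobiusAdd hk hμ, unwrapP_eq hk hμ]
  nth_rw 4 [← hcancel]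
  congr 1
  generalize mobiusAdd (-k ^ 2) (-μ) z = w at *
  rcases eq_or_ne w 0 with rfl | hw0
  · simp [ballPolar]
  have hr : 0 < ‖w‖ := norm_pos_iff.2 hw0
  have hmem : k * ‖w‖ ∈ Set.Ioo (-1 : ℝ) 1 := by
    rw [Set.mem_Ioo, ← abs_lt, ← sq_lt_one_iff_abs_lt_one]; linarith
  have hat : 0 < Real.artanh (k * ‖w‖) := Real.artanh_pos ⟨by positivity, hmem.2⟩
  have hn : k * ‖(2 / k * Real.artanh (k * ‖w‖) / ‖w‖) • w‖ = 2 * Real.artanh (k * ‖w‖) := by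
    rw [norm_smul, Real.norm_of_nonneg (by positivity)]
    field_simp
  rw [ballPolar, hn, mul_div_cancel_left₀ _ two_ne_zero, Real.tanh_artanh hmem, smul_smul]
  convert one_smul ℝ w
  field_simp

/-! ### Jacobians and log-densities -/

/-- If `D` pulls `g` back to `s² ⟨u, w⟩ + β ⟨v, u⟩ ⟨v, w⟩` with `s² + β‖v‖² = 1`, then its Gram
matrix has the eigenvalue `1` along `v` and `s²` orthogonally to `v`. The value `sⁿ / s` stands for
`sⁿ⁻¹` and is also correct for `n = 0`, where `s = 1`. -/
theorem jacobian_of_gram {V : Type} [NormedAddCommGroup V] [NormedSpace ℝ V] {g : V → V → ℝ}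
    {D : Coord n →L[ℝ] V} {v : Coord n} {s β : ℝ} (hs : 0 < s) (hβ : s ^ 2 + β * ‖v‖ ^ 2 = 1)
    (h : ∀ u w, g (D u) (D w) = s ^ 2 * inner ℝ u w + β * (inner ℝ v u * inner ℝ v w)) :
    jacobian g D = s ^ n / s := by
  have hG : (Matrix.of fun i j : Fin n => g (D (EuclideanSpace.single i 1))
        (D (EuclideanSpace.single j 1)))
      = s ^ 2 • (1 + Matrix.replicateCol Unit ((β / s ^ 2) • v.ofLp)
        * Matrix.replicateRow Unit v.ofLp) := by
    ext i j
    rw [Matrix.of_apply, h]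
    simp [EuclideanSpace.inner_single_right, Matrix.mul_apply, Matrix.one_apply, eq_comm]
    field_simp
    split_ifs <;> ring
  have hvv : v.ofLp ⬝ᵥ v.ofLp = ‖v‖ ^ 2 := by
    rw [EuclideanSpace.real_norm_sq_eq, dotProduct]
    exact Finset.sum_congr rfl fun i _ => by ring
  rw [jacobian, hG, Matrix.det_smul, Matrix.det_one_add_replicateCol_mul_replicateRow,
    Fintype.card_fin, dotProduct_smul, hvv, smul_eq_mul,
    show 1 + β / s ^ 2 * ‖v‖ ^ 2 = 1 / s ^ 2 by field_simp; linarith,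
    show (s ^ 2) ^ n * (1 / s ^ 2) = (s ^ n / s) ^ 2 by field_simp; ring,
    Real.sqrt_sq (by positivity)]

theorem differentiable_wrapH {k : ℝ} (hk : 0 < k) {μ : Ambient n}
    (hμ : μ ∈ hyperboloid (-k ^ 2) n) : Differentiable ℝ (wrapH (-k ^ 2) μ) := fun v => by
  obtain ⟨D, hD, -⟩ := exists_hasFDerivAt_polar hk v
  rw [funext (wrapH_eq_boost_polar hk hμ)]
  exact ((boost k μ).hasFDerivAt.comp v hD).differentiableAt

theorem lorentz_fderiv_wrapH {k : ℝ} (hk : 0 < k) {μ : Ambient n}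
    (hμ : μ ∈ hyperboloid (-k ^ 2) n) (v u w : Coord n) :
    lorentz (fderiv ℝ (wrapH (-k ^ 2) μ) v u) (fderiv ℝ (wrapH (-k ^ 2) μ) v w)
      = sinhc (k * ‖v‖) ^ 2 * inner ℝ u w
        + (1 - sinhc (k * ‖v‖) ^ 2) / ‖v‖ ^ 2 * (inner ℝ v u * inner ℝ v w) := by
  obtain ⟨D, hD, hg⟩ := exists_hasFDerivAt_polar hk v
  rw [show wrapH (-k ^ 2) μ = boost k μ ∘ polar k from funext (wrapH_eq_boost_polar hk hμ),
    ((boost k μ).hasFDerivAt.comp v hD).fderiv,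
    ContinuousLinearMap.comp_apply, ContinuousLinearMap.comp_apply, lorentz_boost hk hμ, hg]

theorem jacobian_wrapH {k : ℝ} (hk : 0 < k) {μ : Ambient n} (hμ : μ ∈ hyperboloid (-k ^ 2) n)
    (v : Coord n) : jacobian lorentz (fderiv ℝ (wrapH (-k ^ 2) μ) v)
      = sinhc (k * ‖v‖) ^ n / sinhc (k * ‖v‖) := by
  refine jacobian_of_gram (sinhc_pos _) ?_ (lorentz_fderiv_wrapH hk hμ v)
  rcases eq_or_ne v 0 with rfl | hv
  · simp [sinhc_zero]
  have hr : ‖v‖ ≠ 0 := norm_ne_zero_iff.2 hv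
  field_simp
  ring

/-- The stereographic projection `(ξ; x) ↦ x / (1 + k ξ)` is a left inverse of `rhoInv`. -/
theorem stereographic_rhoInv {k : ℝ} (hk : 0 < k) {y : Coord n}
    (hy : y ∈ poincareBall (-k ^ 2) n) :
    (1 + k * (rhoInv (-k ^ 2) y).1)⁻¹ • (rhoInv (-k ^ 2) y).2 = y := by
  have hB := (mem_poincareBall hk).1 hy
  rw [rhoInv_eq hk]
  have hξ : 1 + k * ((1 + k ^ 2 * ‖y‖ ^ 2) / (k * (1 - k ^ 2 * ‖y‖ ^ 2)))
      = 2 / (1 - k ^ 2 * ‖y‖ ^ 2) := by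
    field_simp; ring
  simp only [hξ]
  rw [inv_smul_smul₀ (by positivity)]

/-- `wrapP` inherits differentiability from `wrapH` through the stereographic projection; this deals
with the point `v = 0`, where the defining formula of `wrapP` is singular. -/
theorem differentiable_wrapP {k : ℝ} (hk : 0 < k) {μ : Coord n}
    (hμ : μ ∈ poincareBall (-k ^ 2) n) : Differentiable ℝ (wrapP (-k ^ 2) μ) := fun v => by
  have h : wrapP (-k ^ 2) μ = fun v => (1 + k * (wrapH (-k ^ 2) (rhoInv (-k ^ 2) μ) v).1)⁻¹ •
      (wrapH (-k ^ 2) (rhoInv (-k ^ 2) μ) v).2 := by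
    funext v
    rw [← rhoInv_wrapP hk hμ, stereographic_rhoInv hk (wrapP_mem_poincareBall hk hμ v)]
  have hd := differentiable_wrapH hk (rhoInv_mem_hyperboloid hk hμ) v
  have hpos := (rhoInv_mem_hyperboloid hk (wrapP_mem_poincareBall hk hμ v)).2
  rw [rhoInv_wrapP hk hμ] at hpos
  have hne : 1 + k * (wrapH (-k ^ 2) (rhoInv (-k ^ 2) μ) v).1 ≠ 0 := by positivity
  rw [h]
  exact ((differentiableAt_const _).add (hd.fst.const_mul k)).inv hne |>.smul hd.snd

/-- The inverse stereographic projection is an isometry from the ball to the hyperboloid. -/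
theorem exists_hasFDerivAt_rhoInv {k : ℝ} (hk : 0 < k) {z : Coord n}
    (hz : z ∈ poincareBall (-k ^ 2) n) :
    ∃ D : Coord n →L[ℝ] Ambient n, HasFDerivAt (rhoInv (-k ^ 2)) D z ∧
      ∀ u w, lorentz (D u) (D w) = metricP (-k ^ 2) z u w := by
  have hq := (mem_poincareBall hk).1 hz
  have hsq := (hasStrictFDerivAt_norm_sq z).hasFDerivAt.const_mul (k ^ 2)
  have hinv := (hasDerivAt_inv hq.ne').comp_hasFDerivAt z (hsq.const_sub 1)
  have h1 := ((hinv.const_mul 2).sub_const 1).mul_const k⁻¹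
  have h2 := (hinv.const_mul 2).smul (hasFDerivAt_id z)
  refine ⟨_, (h1.prodMk h2).congr_of_eventuallyEq ?_, fun u w => ?_⟩
  · have hc : Continuous fun y : Coord n => 1 - k ^ 2 * ‖y‖ ^ 2 := by fun_prop
    filter_upwards [hc.continuousAt.eventually (lt_mem_nhds hq)] with y hy
    rw [rhoInv_eq hk]
    refine Prod.ext ?_ ?_
    · simp
      field_simp
      ring
    · simp [div_eq_mul_inv]
  · simp only [lorentz, metricP, conformalFactor_neg_sq, ContinuousLinearMap.prod_apply,
      smul_apply, add_apply, neg_apply, ContinuousLinearMap.smulRight_apply, innerSL_apply_apply,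
      ContinuousLinearMap.id_apply, id, Function.comp, inner_add_left, inner_add_right,
      inner_smul_left, inner_smul_right, smul_eq_mul, real_inner_self_eq_norm_sq,
      RCLike.conj_to_real, real_inner_comm z u, nsmul_eq_mul]
    field_simp
    ring

theorem metricP_fderiv_wrapP {k : ℝ} (hk : 0 < k) {μ : Coord n}
    (hμ : μ ∈ poincareBall (-k ^ 2) n) (v u w : Coord n) :
    metricP (-k ^ 2) (wrapP (-k ^ 2) μ v) (fderiv ℝ (wrapP (-k ^ 2) μ) v u)
        (fderiv ℝ (wrapP (-k ^ 2) μ) v w)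
      = lorentz (fderiv ℝ (wrapH (-k ^ 2) (rhoInv (-k ^ 2) μ)) v u)
        (fderiv ℝ (wrapH (-k ^ 2) (rhoInv (-k ^ 2) μ)) v w) := by
  obtain ⟨D, hD, hg⟩ := exists_hasFDerivAt_rhoInv hk (wrapP_mem_poincareBall hk hμ v)
  rw [← hg, ← ContinuousLinearMap.comp_apply, ← ContinuousLinearMap.comp_apply,
    ← (hD.comp v (differentiable_wrapP hk hμ v).hasFDerivAt).fderiv]
  rw [show rhoInv (-k ^ 2) ∘ wrapP (-k ^ 2) μ = wrapH (-k ^ 2) (rhoInv (-k ^ 2) μ) from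
    funext (rhoInv_wrapP hk hμ)]

theorem jacobian_wrapP {k : ℝ} (hk : 0 < k) {μ : Coord n} (hμ : μ ∈ poincareBall (-k ^ 2) n)
    (v : Coord n) :
    jacobian (metricP (-k ^ 2) (wrapP (-k ^ 2) μ v)) (fderiv ℝ (wrapP (-k ^ 2) μ) v)
      = jacobian lorentz (fderiv ℝ (wrapH (-k ^ 2) (rhoInv (-k ^ 2) μ)) v) := by
  simp only [jacobian, metricP_fderiv_wrapP hk hμ]

theorem logWNP_wrapP {k : ℝ} (hk : 0 < k) {μ : Coord n} (hμ : μ ∈ poincareBall (-k ^ 2) n)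
    (S : Matrix (Fin n) (Fin n) ℝ) (v : Coord n) :
    logWNP (-k ^ 2) (wrapP (-k ^ 2) μ v) μ S = Real.log (gaussianDensity S v)
      - Real.log (sinhc (k * ‖v‖) ^ n / sinhc (k * ‖v‖)) := by
  rw [logWNP, unwrapP_wrapP hk hμ, jacobian_wrapP hk hμ,
    jacobian_wrapH hk (rhoInv_mem_hyperboloid hk hμ)]

theorem logWNH_wrapH {k : ℝ} (hk : 0 < k) {μ : Ambient n} (hμ : μ ∈ hyperboloid (-k ^ 2) n)
    (S : Matrix (Fin n) (Fin n) ℝ) (v : Coord n) :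
    logWNH (-k ^ 2) (wrapH (-k ^ 2) μ v) μ S = Real.log (gaussianDensity S v)
      - Real.log (sinhc (k * ‖v‖) ^ n / sinhc (k * ‖v‖)) := by
  rw [logWNH, unwrapH_wrapH hk hμ, jacobian_wrapH hk hμ]

theorem distP_wrapP {k : ℝ} (hk : 0 < k) {μ : Coord n} (hμ : μ ∈ poincareBall (-k ^ 2) n)
    (v : Coord n) : distP (-k ^ 2) μ (wrapP (-k ^ 2) μ v) = ‖v‖ := by
  rw [distP, ← lorentz_rhoInv hk hμ (wrapP_mem_poincareBall hk hμ v), rhoInv_wrapP hk hμ,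
    neg_sq_mul_lorentz_wrapH hk (rhoInv_mem_hyperboloid hk hμ), Real.arcosh_cosh (by positivity),
    neg_neg, Real.sqrt_sq hk.le]
  field_simp

theorem gaussianDensity_pos {S : Matrix (Fin n) (Fin n) ℝ} (hS : S.PosDef) (v : Coord n) :
    0 < gaussianDensity S v := by
  have := hS.det_pos
  rw [gaussianDensity]
  positivity

theorem log_gaussianDensity_smul_one {σ : ℝ} (hσ : 0 < σ) (v : Coord n) :
    Real.log (gaussianDensity ((σ ^ 2) • (1 : Matrix (Fin n) (Fin n) ℝ)) v)
      = -(‖v‖ ^ 2 / (2 * σ ^ 2)) - (n : ℝ) / 2 * Real.log (2 * Real.pi * σ ^ 2) := by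
  have hvv : v.ofLp ⬝ᵥ v.ofLp = ‖v‖ ^ 2 := by
    rw [EuclideanSpace.real_norm_sq_eq, dotProduct]
    exact Finset.sum_congr rfl fun i _ => by ring
  have hinv : ((σ ^ 2) • (1 : Matrix (Fin n) (Fin n) ℝ))⁻¹ = (σ ^ 2)⁻¹ • 1 := by
    refine Matrix.inv_eq_left_inv ?_
    simp [smul_smul, hσ.ne']
  rw [gaussianDensity, hinv, Matrix.smul_mulVec, Matrix.one_mulVec, dotProduct_smul, hvv,
    Matrix.det_smul, Matrix.det_one, Fintype.card_fin, mul_one, ← mul_pow,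
    Real.log_div (Real.exp_ne_zero _) (by positivity), Real.log_exp, Real.log_sqrt (by positivity),
    Real.log_pow, smul_eq_mul]
  field_simp

/-! ### Densities with respect to the Riemannian volume -/

theorem isLinearMap_lorentz_left (w : Ambient n) : IsLinearMap ℝ fun u => lorentz u w where
  map_add u v := by simp only [lorentz, Prod.fst_add, Prod.snd_add, inner_add_left]; ring
  map_smul c u := by
    simp only [lorentz, Prod.smul_fst, Prod.smul_snd, real_inner_smul_left, smul_eq_mul]; ring

theorem isLinearMap_lorentz_right (u : Ambient n) : IsLinearMap ℝ (lorentz u) where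
  map_add v w := by simp only [lorentz, Prod.fst_add, Prod.snd_add, inner_add_right]; ring
  map_smul c w := by
    simp only [lorentz, Prod.smul_fst, Prod.smul_snd, real_inner_smul_right, smul_eq_mul]; ring

theorem isLinearMap_metricP_left (K : ℝ) (x w : Coord n) :
    IsLinearMap ℝ fun u => metricP K x u w where
  map_add u v := by simp only [metricP, inner_add_left]; ring
  map_smul c u := by simp only [metricP, real_inner_smul_left, smul_eq_mul]; ring

theorem isLinearMap_metricP_right (K : ℝ) (x u : Coord n) : IsLinearMap ℝ (metricP K x u) where
  map_add v w := by simp only [metricP, inner_add_right]; ring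
  map_smul c w := by simp only [metricP, real_inner_smul_right, smul_eq_mul]; ring

theorem measurable_gaussianDensity (S : Matrix (Fin n) (Fin n) ℝ) :
    Measurable (gaussianDensity S) := by
  unfold gaussianDensity
  simp only [dotProduct, Matrix.mulVec]
  fun_prop

theorem measurable_conformalFactor (K : ℝ) : Measurable (conformalFactor (n := n) K) := by
  unfold conformalFactor
  fun_prop

theorem measurable_mobiusAdd (K : ℝ) (x : Coord n) : Measurable (mobiusAdd K x) := by
  unfold mobiusAdd
  fun_prop

theorem measurable_unwrapP (K : ℝ) (μ : Coord n) : Measurable (unwrapP K μ) := by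
  have := measurable_mobiusAdd K (-μ)
  unfold unwrapP transportToOriginP logP Real.artanh
  fun_prop

theorem measurable_unwrapH (K : ℝ) (μ : Ambient n) : Measurable (unwrapH K μ) := by
  have : Measurable (lorentz μ) := by unfold lorentz; fun_prop
  have : Measurable (lorentz (originH K n)) := by unfold lorentz; fun_prop
  unfold unwrapH transportH logH Real.arcosh
  fun_prop

theorem measurable_logWNP (K : ℝ) (μ : Coord n) (S : Matrix (Fin n) (Fin n) ℝ) :
    Measurable fun z => logWNP K z μ S := by
  have hu := measurable_unwrapP K μ
  refine ((measurable_gaussianDensity S).comp hu).log.sub (Measurable.log ?_)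
  refine measurable_jacobian fun i j => ?_
  have hd (i : Fin n) := (measurable_fderiv_apply_const ℝ (wrapP K μ)
    (EuclideanSpace.single i 1)).comp hu
  exact ((measurable_conformalFactor K).pow_const 2).mul ((hd i).inner (hd j))

theorem measurable_logWNH (K : ℝ) (μ : Ambient n) (S : Matrix (Fin n) (Fin n) ℝ) :
    Measurable fun z => logWNH K z μ S := by
  have hu := measurable_unwrapH K μ
  refine ((measurable_gaussianDensity S).comp hu).log.sub (Measurable.log ?_)
  refine measurable_jacobian fun i j => ?_
  have hd (i : Fin n) := (measurable_fderiv_apply_const ℝ (wrapH K μ)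
    (EuclideanSpace.single i 1)).comp hu
  exact ((hd i).fst.mul (hd j).fst).neg.add ((hd i).snd.inner (hd j).snd)

theorem mul_exp_log_sub_log {a b : ℝ} (ha : 0 < a) (hb : 0 < b) :
    b * Real.exp (Real.log a - Real.log b) = a := by
  rw [Real.exp_sub, Real.exp_log ha, Real.exp_log hb]
  field_simp

theorem wrappedNormalP_eq_withDensity {k : ℝ} (hk : 0 < k) {μ : Coord n}
    (hμ : μ ∈ poincareBall (-k ^ 2) n) {S : Matrix (Fin n) (Fin n) ℝ} (hS : S.PosDef) :
    wrappedNormalP (-k ^ 2) μ S = (volumeP (-k ^ 2) n).withDensity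
      fun z => ENNReal.ofReal (Real.exp (logWNP (-k ^ 2) z μ S)) := by
  rw [wrappedNormalP, multivariateGaussian_eq_withDensity hS, volumeP,
    ← map_eq_riemannianVolume_withDensity (T := wrapP (-k ^ 2) μ) (p := gaussianDensity S)
      (fun x w => isLinearMap_metricP_left _ x w) (fun x u => isLinearMap_metricP_right _ x u)
      measurable_id (fun _ _ => differentiableAt_id) ?_ (measurable_logWNP _ μ S).exp
      (differentiable_wrapP hk hμ) (Function.LeftInverse.injective (unwrapP_wrapP hk hμ)) ?_
      fun v => ?_, Function.id_comp]
  · refine measurable_jacobian fun i j => ?_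
    simp only [fderiv_id, metricP]
    exact ((measurable_conformalFactor _).pow_const 2).mul_const _
  · refine Set.Subset.antisymm ?_ fun z hz => ⟨_, wrapP_unwrapP hk hμ hz⟩
    rintro _ ⟨v, rfl⟩
    exact wrapP_mem_poincareBall hk hμ v
  · rw [Function.id_comp, id, jacobian_wrapP hk hμ,
      jacobian_wrapH hk (rhoInv_mem_hyperboloid hk hμ), logWNP_wrapP hk hμ]
    have := sinhc_pos (k * ‖v‖)
    exact mul_exp_log_sub_log (gaussianDensity_pos hS v) (by positivity)

/-- The parametrization of the hyperboloid by the last `n` coordinates. -/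
noncomputable def hyperboloidGraph (K : ℝ) (x : Coord n) : Ambient n := (√(‖x‖ ^ 2 - 1 / K), x)

theorem differentiable_hyperboloidGraph {k : ℝ} (hk : 0 < k) :
    Differentiable ℝ (hyperboloidGraph (n := n) (-k ^ 2)) := fun x => by
  have h : ‖x‖ ^ 2 - 1 / -k ^ 2 ≠ 0 := by
    rw [div_neg, sub_neg_eq_add]
    positivity
  have h2 : DifferentiableAt ℝ (fun x : Coord n => ‖x‖ ^ 2 - 1 / -k ^ 2) x :=
    (differentiableAt_id.norm_sq ℝ).sub_const _
  exact (h2.sqrt h).prodMk differentiableAt_id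

theorem hyperboloidGraph_snd {k : ℝ} {p : Ambient n}
    (hp : p ∈ hyperboloid (-k ^ 2) n) : hyperboloidGraph (-k ^ 2) p.2 = p := by
  have h := sq_fst_of_mem_hyperboloid hp
  refine Prod.ext ?_ rfl
  rw [hyperboloidGraph, div_neg, sub_neg_eq_add, ← h, Real.sqrt_sq hp.2.le]

/-- Followed by the projection to the last `n` coordinates, `rhoInv` is onto `ℝⁿ`: the preimage
of `w` is `w / (1 + c)` with `c = √(1 + k²‖w‖²)`. -/
theorem exists_snd_rhoInv_eq {k : ℝ} (hk : 0 < k) (w : Coord n) :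
    ∃ y ∈ poincareBall (-k ^ 2) n, (rhoInv (-k ^ 2) y).2 = w := by
  set c := √(1 + k ^ 2 * ‖w‖ ^ 2) with hc
  have hc0 : 0 < c := by positivity
  have hc2 : k ^ 2 * ‖w‖ ^ 2 = c ^ 2 - 1 := by rw [hc, Real.sq_sqrt (by positivity)]; ring
  have hy : 1 - k ^ 2 * ‖(1 + c)⁻¹ • w‖ ^ 2 = 2 / (1 + c) := by
    rw [norm_smul, Real.norm_of_nonneg (by positivity), mul_pow, mul_left_comm, hc2]
    field_simp
    ring
  refine ⟨(1 + c)⁻¹ • w, (mem_poincareBall hk).2 (by rw [hy]; positivity), ?_⟩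
  rw [rhoInv_eq hk]
  simp only [hy]
  rw [smul_smul]
  convert one_smul ℝ w
  field_simp

/-- In the coordinates of the graph parametrization, `wrapH` is a bijection of `ℝⁿ`: it is injective
since `unwrapH` is a left inverse, and onto since every point of the hyperboloid comes from the ball,
where `unwrapP` provides a preimage. -/
theorem wrappedNormalH_eq_withDensity {k : ℝ} (hk : 0 < k) {μ : Coord n}
    (hμ : μ ∈ poincareBall (-k ^ 2) n) {S : Matrix (Fin n) (Fin n) ℝ} (hS : S.PosDef) :
    wrappedNormalH (-k ^ 2) (rhoInv (-k ^ 2) μ) S = (volumeH (-k ^ 2) n).withDensity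
      fun w => ENNReal.ofReal (Real.exp (logWNH (-k ^ 2) w (rhoInv (-k ^ 2) μ) S)) := by
  have hμ' := rhoInv_mem_hyperboloid hk hμ
  set p := rhoInv (-k ^ 2) μ
  have hmem (v : Coord n) : wrapH (-k ^ 2) p v ∈ hyperboloid (-k ^ 2) n := by
    rw [← rhoInv_wrapP hk hμ]
    exact rhoInv_mem_hyperboloid hk (wrapP_mem_poincareBall hk hμ v)
  have hgraph (v : Coord n) : hyperboloidGraph (-k ^ 2) (wrapH (-k ^ 2) p v).2
      = wrapH (-k ^ 2) p v := hyperboloidGraph_snd (hmem v)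
  have hcomp : hyperboloidGraph (-k ^ 2) ∘ (fun v => (wrapH (-k ^ 2) p v).2) = wrapH (-k ^ 2) p :=
    funext hgraph
  have hφ := differentiable_hyperboloidGraph (n := n) hk
  rw [wrappedNormalH, multivariateGaussian_eq_withDensity hS, volumeH]
  change _ = (riemannianVolume _ _ (hyperboloidGraph (-k ^ 2))).withDensity _
  rw [← map_eq_riemannianVolume_withDensity (T := fun v => (wrapH (-k ^ 2) p v).2)
      (p := gaussianDensity S)
      (fun _ w => isLinearMap_lorentz_left w) (fun _ u => isLinearMap_lorentz_right u)
      hφ.continuous.measurable (fun x _ => hφ x) ?_ (measurable_logWNH _ p S).exp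
      (fun v => (differentiable_wrapH hk hμ' v).snd) (fun v w hvw => ?_)
      (Set.range_eq_univ.2 fun w => ?_) fun v => ?_, hcomp]
  · refine measurable_jacobian fun i j => ?_
    have hd (i : Fin n) := measurable_fderiv_apply_const ℝ (hyperboloidGraph (n := n) (-k ^ 2))
      (EuclideanSpace.single i 1)
    exact ((hd i).fst.mul (hd j).fst).neg.add ((hd i).snd.inner (hd j).snd)
  · refine Function.LeftInverse.injective (unwrapH_wrapH hk hμ') ?_
    rw [← hgraph v, ← hgraph w]
    exact congrArg _ hvw
  · obtain ⟨y, hy, hyw⟩ := exists_snd_rhoInv_eq hk w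
    refine ⟨unwrapP (-k ^ 2) μ y, ?_⟩
    rw [← hyw, ← rhoInv_wrapP hk hμ, wrapP_unwrapP hk hμ hy]
  · rw [hcomp, hgraph, jacobian_wrapH hk hμ', logWNH_wrapH hk hμ']
    have := sinhc_pos (k * ‖v‖)
    exact mul_exp_log_sub_log (gaussianDensity_pos hS v) (by positivity)

end WrappedNormal

open WrappedNormal
theorem mainTheorem11 (n : ℕ) (K : ℝ) (hK : K < 0) (μ : Coord n) (hμ : μ ∈ poincareBall K n) :
    (∀ S : Matrix (Fin n) (Fin n) ℝ, S.PosDef →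
      wrappedNormalP K μ S =
          (volumeP K n).withDensity (fun z => ENNReal.ofReal (Real.exp (logWNP K z μ S))) ∧
        wrappedNormalH K (rhoInv K μ) S =
          (volumeH K n).withDensity
            (fun w => ENNReal.ofReal (Real.exp (logWNH K w (rhoInv K μ) S))) ∧
        ∀ z ∈ poincareBall K n,
          rhoInv K z ∈ hyperboloid K n ∧
            logWNP K z μ S = logWNH K (rhoInv K z) (rhoInv K μ) S) ∧
      ∀ σ : ℝ, 0 < σ → ∀ z ∈ poincareBall K n,
        logWNP K z μ ((σ ^ 2) • (1 : Matrix (Fin n) (Fin n) ℝ)) =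
          -(distP K μ z ^ 2 / (2 * σ ^ 2)) - (n : ℝ) / 2 * Real.log (2 * Real.pi * σ ^ 2)
            + ((n : ℝ) - 1) *
              Real.log (√(-K) * distP K μ z / Real.sinh (√(-K) * distP K μ z)) := by
  obtain ⟨k, hk, rfl⟩ : ∃ k : ℝ, 0 < k ∧ K = -k ^ 2 :=
    ⟨√(-K), Real.sqrt_pos.2 (neg_pos.2 hK), by rw [Real.sq_sqrt (neg_pos.2 hK).le, neg_neg]⟩
  refine ⟨fun S hS => ⟨wrappedNormalP_eq_withDensity hk hμ hS,
    wrappedNormalH_eq_withDensity hk hμ hS, fun z hz => ⟨rhoInv_mem_hyperboloid hk hz, ?_⟩⟩,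
    fun σ hσ z hz => ?_⟩
  · rw [← wrapP_unwrapP hk hμ hz, logWNP_wrapP hk hμ, rhoInv_wrapP hk hμ,
      logWNH_wrapH hk (rhoInv_mem_hyperboloid hk hμ)]
  · obtain ⟨v, rfl⟩ : ∃ v, wrapP (-k ^ 2) μ v = z := ⟨_, wrapP_unwrapP hk hμ hz⟩
    have hs := sinhc_pos (k * ‖v‖)
    rw [logWNP_wrapP hk hμ, distP_wrapP hk hμ, log_gaussianDensity_smul_one hσ, neg_neg,
      Real.sqrt_sq hk.le, ← inv_div (Real.sinh _), Real.log_inv, ← log_sinhc,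
      Real.log_div (by positivity) hs.ne', Real.log_pow]
    ring
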